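/- A \emph{max-min LP} consists of disjoint finite sets $V$ (agents), $I$ (constraints), $K$ (objectives), a graph $\mathcal G$ on $V\cup I\cup K$ each of whose edges joins an agent to an element of $I\cup K$, and coefficients $a_{iv}\ge 0$, $c_{kv}\ge 0$ on the edges $\{i,v\}$, $\{k,v\}$. With $V_j$ denoting the set of agents adjacent to $j\in I\cup K$, the task is to maximise $\min_{k\in K}\sum_{v\in V_k}c_{kv}x_v$ subject to $\sum_{v\in V_i}a_{iv}x_v\le 1$ for all $i\in I$ and $x_v\ge 0$ for all $v\in V$; its optimum is $\omega^*$. It is \emph{bipartite} if every agent is adjacent to exactly one constraint and exactly one objective. Let $B(s,r)$ be the set of vertices at distance at most $r$ from $s$ in $\mathcal G$; $\mathcal G$ has \emph{bounded relative growth} $1+\delta$ \emph{beyond radius} $R$ if $|V\cap B(v,r+2)|/|V\cap B(v,r)|\le 1+\delta$ for all $v\in V$ and all integers $r\ge R$. The nodes carry unique identifiers (natural numbers) and a port numbering (each node numbers its incident edges). The local input of an agent consists of its identifier, its adjacent constraints and objectives (identifiers and port numbers), and the coefficients on its edges; the local input of a constraint or an objective consists of its identifier and its adjacent agents (identifiers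 and port numbers). A \emph{local approximation algorithm} with local horizon $r\in\mathbb N$ and approximation ratio $\alpha\ge 1$ for a family of max-min LPs is a deterministic rule which determines each $x_v$ as a function of the identifier of $v$ and the local inputs of the nodes in $B(v,r)$ such that, for every member of the family and all identifiers and port numberings, $x$ is feasible and $\sum_{v\in V_k}c_{kv}x_v\ge\omega^*/\alpha$ for all $k\in K$; the rule, $r$ and $\alpha$ do not depend on the member. \textbf{Theorem.} Let $\Delta_I\ge 3$ and $\Delta_K\ge 3$ be integers and let $0<\delta<1/10$. There is no local approximation algorithm with an approximation ratio $\alpha<1+\delta/2$ for the max-min LPs with $|V_i|\le\Delta_I$ for all $i\in I$ and $|V_k|\le\Delta_K$ for all $k\in K$. Moreover, there is a constant $R\in\mathbb N$ such that no such algorithm exists even for the subfamily of those max-min LPs that are bipartite, have only strictly positive coefficients, and whose graph $\mathcal G$ has bounded relative growth $1+\delta$ beyond radius $R$. -/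

import Mathlib

/-- A finite max-min linear program together with its communication graph.
`V` are the agents, `I` the constraints, `K` the objectives; `conEdge i v` says that
`{v, i}` is an edge and `objEdge k v` that `{v, k}` is an edge.  The coefficients `a i v`, `c k v`
are only meaningful (and only used) on edges. -/
structure MaxMinLP where
  V : Type
  I : Type
  K : Type
  [fintypeV : Fintype V]
  [fintypeI : Fintype I]
  [fintypeK : Fintype K]
  conEdge : I → V → Prop
  objEdge : K → V → Prop
  a : I → V → ℝ
  c : K → V → ℝ
  a_nonneg : ∀ i v, conEdge i v → 0 ≤ a i v
  c_nonneg : ∀ k v, objEdge k v → 0 ≤ c k v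

attribute [instance] MaxMinLP.fintypeV MaxMinLP.fintypeI MaxMinLP.fintypeK

namespace MaxMinLP

noncomputable section

/-- The vertices of the communication graph: the disjoint union of `V`, `I` and `K`. -/
inductive Node (L : MaxMinLP) : Type
  | agent (v : L.V) : Node L
  | con (i : L.I) : Node L
  | obj (k : L.K) : Node L

/-- The communication graph. -/
def graph (L : MaxMinLP) : SimpleGraph L.Node where
  Adj s t :=
    match s, t with
    | .agent v, .con i => L.conEdge i v
    | .con i, .agent v => L.conEdge i v
    | .agent v, .obj k => L.objEdge k v
    | .obj k, .agent v => L.objEdge k v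
    | _, _ => False
  symm := ⟨by
    intro s t h
    cases s <;> cases t <;> exact h⟩
  loopless := ⟨by
    intro s h
    cases s <;> exact h⟩

/-- The ball `B(s, r)`: the vertices within distance at most `r` from `s`
(`edist` is `⊤` between different connected components). -/
def ball (L : MaxMinLP) (s : L.Node) (r : ℕ) : Set L.Node :=
  {t | L.graph.edist s t ≤ (r : ℕ∞)}

open Classical in
/-- `V_i`: the agents adjacent to a constraint `i`. -/
def conAgents (L : MaxMinLP) (i : L.I) : Finset L.V :=
  Finset.univ.filter fun v => L.conEdge i v

open Classical in
/-- `V_k`: the agents adjacent to an objective `k`. -/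
def objAgents (L : MaxMinLP) (k : L.K) : Finset L.V :=
  Finset.univ.filter fun v => L.objEdge k v

/-- The value of the constraint `i` at `x`. -/
def conValue (L : MaxMinLP) (x : L.V → ℝ) (i : L.I) : ℝ :=
  ∑ v ∈ L.conAgents i, L.a i v * x v

/-- The value of the objective `k` at `x`. -/
def objValue (L : MaxMinLP) (x : L.V → ℝ) (k : L.K) : ℝ :=
  ∑ v ∈ L.objAgents k, L.c k v * x v

/-- Feasible solutions. -/
def Feasible (L : MaxMinLP) (x : L.V → ℝ) : Prop :=
  (∀ i, L.conValue x i ≤ 1) ∧ ∀ v, 0 ≤ x v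

/-- The utility of `x`, the minimum of the objectives (`⊤` if there are no objectives). -/
def utility (L : MaxMinLP) (x : L.V → ℝ) : EReal :=
  ⨅ k, (L.objValue x k : EReal)

/-- The optimum of the max-min LP (`⊤` if the utility is unbounded). -/
def opt (L : MaxMinLP) : EReal :=
  ⨆ x ∈ {x | L.Feasible x}, L.utility x

/-- The degree bounds `|V_i| ≤ ΔI` and `|V_k| ≤ ΔK`. -/
def DegreeBounded (L : MaxMinLP) (ΔI ΔK : ℕ) : Prop :=
  (∀ i, (L.conAgents i).card ≤ ΔI) ∧ ∀ k, (L.objAgents k).card ≤ ΔK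

/-- The bipartite version: each agent is adjacent to exactly one constraint and exactly one
objective. -/
def IsBipartite (L : MaxMinLP) : Prop :=
  ∀ v, (∃! i, L.conEdge i v) ∧ ∃! k, L.objEdge k v

/-- All coefficients on the edges are strictly positive. -/
def PositiveCoefficients (L : MaxMinLP) : Prop :=
  (∀ i v, L.conEdge i v → 0 < L.a i v) ∧ ∀ k v, L.objEdge k v → 0 < L.c k v

/-- The number `|V ∩ B(v, r)|` of agents within distance `r` from the agent `v`. -/
def ballAgentCount (L : MaxMinLP) (v : L.V) (r : ℕ) : ℕ :=
  {u : L.V | Node.agent u ∈ L.ball (Node.agent v) r}.ncard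

/-- Bounded relative growth `1 + δ` beyond radius `R`. -/
def BoundedRelativeGrowth (L : MaxMinLP) (δ : ℝ) (R : ℕ) : Prop :=
  ∀ (v : L.V) (r : ℕ), R ≤ r →
    (L.ballAgentCount v (r + 2) : ℝ) / (L.ballAgentCount v r : ℝ) ≤ 1 + δ

/-- The symmetry-breaking information of a network: unique identifiers and a port numbering.
`port s t` is the number that `s` gives to its edge `{s, t}`; the edges incident to `s` get
distinct numbers `0, …, deg s - 1` (values off the edges are never used). -/
structure Labelling (L : MaxMinLP) where
  ident : L.Node → ℕ
  ident_injective : Function.Injective ident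
  port : L.Node → L.Node → ℕ
  port_lt : ∀ s t, L.graph.Adj s t → port s t < (L.graph.neighborSet s).ncard
  port_injOn : ∀ s, Set.InjOn (port s) (L.graph.neighborSet s)

/-- What a single node is given as input.  An agent gets its adjacent constraints and its adjacent
objectives, as triples (identifier, port, coefficient); a constraint or an objective gets its
adjacent agents, as pairs (identifier, port). -/
inductive LocalInput : Type
  | agent (cons objs : Set (ℕ × ℕ × ℝ)) : LocalInput
  | con (agents : Set (ℕ × ℕ)) : LocalInput
  | obj (agents : Set (ℕ × ℕ)) : LocalInput

/-- The local input of a node. -/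
def Labelling.localInput {L : MaxMinLP} (N : L.Labelling) : L.Node → LocalInput
  | .agent v => .agent
      {p | ∃ i, L.conEdge i v ∧ p = (N.ident (.con i), N.port (.agent v) (.con i), L.a i v)}
      {p | ∃ k, L.objEdge k v ∧ p = (N.ident (.obj k), N.port (.agent v) (.obj k), L.c k v)}
  | .con i => .con
      {p | ∃ v, L.conEdge i v ∧ p = (N.ident (.agent v), N.port (.con i) (.agent v))}
  | .obj k => .obj
      {p | ∃ v, L.objEdge k v ∧ p = (N.ident (.agent v), N.port (.obj k) (.agent v))}

/-- All that the agent `v` can learn with local horizon `r`: the local inputs of the nodes in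
`B(v, r)`, tagged with the identifiers of these nodes. -/
def Labelling.view {L : MaxMinLP} (N : L.Labelling) (v : L.V) (r : ℕ) : Set (ℕ × LocalInput) :=
  (fun t => (N.ident t, N.localInput t)) '' L.ball (.agent v) r

/-- A deterministic rule that determines an agent's output from its own identifier and its view. -/
abbrev LocalRule : Type := ℕ → Set (ℕ × LocalInput) → ℝ

/-- The output of the rule `A`, run with local horizon `r`. -/
def Labelling.output {L : MaxMinLP} (N : L.Labelling) (A : LocalRule) (r : ℕ) : L.V → ℝ :=
  fun v => A (N.ident (.agent v)) (N.view v r)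

/-- The rule `A` with local horizon `r` is a local approximation algorithm with approximation
ratio `α` for the family `F` of max-min LPs: on each member of the family, for every choice of
identifiers and port numbers, the output is feasible and each objective is at least `opt / α`. -/
def IsLocalApproximation (A : LocalRule) (r : ℕ) (α : ℝ) (F : Set MaxMinLP) : Prop :=
  1 ≤ α ∧ ∀ L ∈ F, ∀ N : L.Labelling,
    L.Feasible (N.output A r) ∧
      ∀ k, L.opt / (α : EReal) ≤ (L.objValue (N.output A r) k : EReal)

end

end MaxMinLP

/-! The obstruction is that a cubic multigraph and a forest can look alike locally while having
different optima. Replace each edge of a multigraph by a path of `2 * n + 2` agents with unit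
coefficients: every branch vertex is a constraint, and along the path objectives and inner
constraints alternate, each on two consecutive agents.

If `3 * |U| = 2 * |E|`, double counting defeats every feasible solution. Each agent lies in one
constraint and one objective, so the objectives sum to at most the number of constraints, `(n + 2/3)
* |E|`. There are `(n + 1) * |E|` objectives, so one of them is at most `(3n+2)/(3n+3)`
(`exists_objValue_le`). If instead the edges can be assigned injectively to their ends, as in a
forest, the optimum is at least 1 (`one_le_opt_subdivision`).

Run the algorithm on a subdivided cubic Cayley graph without short cycles and take a bad objective.
The edges near it form a forest, and on the subdivision of that forest the two agents of the
objective see the same view (`Embedding.output_pullback`). Hence the same output faces an optimum of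
at least 1, which forces `α ≥ (3n+3)/(3n+2)` (`le_ratio_of_isLocalApproximation`).

Bounded growth holds for subdivisions of all multigraphs of maximum degree three
(`boundedRelativeGrowth_subdivision`): one step adds at most one agent per completely explored path,
plus 8, and each such path contains `2 * n + 2` agents. Taking `n` near `1 / (2δ)` meets both the
growth and the ratio requirement. -/

namespace MaxMinLP

/-! ### Balls in the communication graph -/

section Balls

variable {L : MaxMinLP}

instance : Finite L.Node :=
  Finite.of_injective
    (fun t : L.Node => match t with
      | .agent v => (Sum.inl v : L.V ⊕ (L.I ⊕ L.K))
      | .con i => Sum.inr (Sum.inl i)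
      | .obj k => Sum.inr (Sum.inr k))
    (by
      intro s t h
      cases s <;> cases t <;> simp_all)

theorem mem_ball_zero {s t : L.Node} : t ∈ L.ball s 0 ↔ s = t := by
  simp only [ball, Set.mem_ofPred_eq, Nat.cast_zero, nonpos_iff_eq_zero,
    SimpleGraph.edist_eq_zero_iff]

theorem ball_mono (s : L.Node) {m n : ℕ} (h : m ≤ n) : L.ball s m ⊆ L.ball s n := by
  intro t ht
  have hmn : (m : ℕ∞) ≤ n := by exact_mod_cast h
  exact le_trans (show L.graph.edist s t ≤ m from ht) hmn

theorem mem_ball_succ {s t : L.Node} {n : ℕ} :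
    t ∈ L.ball s (n + 1) ↔ ∃ u ∈ L.ball s n, u = t ∨ L.graph.Adj u t := by
  constructor
  · intro h
    have hne : L.graph.edist s t ≠ ⊤ := ne_top_of_le_ne_top (by simp) h
    obtain ⟨w, hw⟩ := SimpleGraph.exists_walk_of_edist_ne_top hne
    have hlen : w.length ≤ n + 1 := by
      have : (w.length : ℕ∞) ≤ ((n + 1 : ℕ) : ℕ∞) := hw ▸ h
      exact_mod_cast this
    by_cases hnil : w.Nil
    · exact ⟨t, by simp [ball, hnil.eq], Or.inl rfl⟩
    · refine ⟨w.penultimate, ?_, Or.inr (w.adj_penultimate hnil)⟩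
      refine (w.dropLast.edist_le).trans ?_
      have : w.dropLast.length ≤ n := by
        have := w.length_dropLast_add_one hnil
        omega
      exact_mod_cast this
  · rintro ⟨u, hu, rfl | hadj⟩
    · exact ball_mono s n.le_succ hu
    · refine (SimpleGraph.edist_triangle (v := u)).trans ?_
      rw [SimpleGraph.edist_eq_one_iff_adj.2 hadj]
      push_cast
      exact add_le_add_left hu 1

end Balls

/-! ### Indistinguishability of an LP and an induced sub-LP -/

/-- The labelling in which every node numbers its edges by increasing identifiers. -/
noncomputable def rankLabelling (L : MaxMinLP) (ident : L.Node → ℕ)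
    (hident : Function.Injective ident) : L.Labelling where
  ident := ident
  ident_injective := hident
  -- Ports are computed from identifiers, so they agree in an LP and a sub-LP at every node all of
  -- whose neighbours are kept.
  port s t := {u | L.graph.Adj s u ∧ ident u < ident t}.ncard
  port_lt s t h := by
    refine Set.ncard_lt_ncard ?_ (Set.toFinite _)
    refine ⟨fun u hu => hu.1, fun hsub => ?_⟩
    exact lt_irrefl _ (hsub (a := t) h).2
  port_injOn s := by
    have key : ∀ t u, L.graph.Adj s t → ident t < ident u →
        {x | L.graph.Adj s x ∧ ident x < ident t}.ncard <
          {x | L.graph.Adj s x ∧ ident x < ident u}.ncard := by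
      intro t u ht htu
      refine Set.ncard_lt_ncard ⟨fun x hx => ⟨hx.1, hx.2.trans htu⟩, fun hsub => ?_⟩
        (Set.toFinite _)
      exact lt_irrefl _ (hsub (a := t) ⟨ht, htu⟩).2
    intro t ht u hu htu
    rcases lt_trichotomy (ident t) (ident u) with h | h | h
    · exact absurd htu (key t u ht h).ne
    · exact hident h
    · exact absurd htu (key u t hu h).ne'

/-- An embedding of max-min LPs: the image is an induced sub-LP. -/
structure Embedding (L' L : MaxMinLP) where
  onV : L'.V → L.V
  onI : L'.I → L.I
  onK : L'.K → L.K
  onV_injective : Function.Injective onV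
  onI_injective : Function.Injective onI
  onK_injective : Function.Injective onK
  conEdge_iff : ∀ i v, L.conEdge (onI i) (onV v) ↔ L'.conEdge i v
  objEdge_iff : ∀ k v, L.objEdge (onK k) (onV v) ↔ L'.objEdge k v
  a_eq : ∀ i v, L.a (onI i) (onV v) = L'.a i v
  c_eq : ∀ k v, L.c (onK k) (onV v) = L'.c k v

namespace Embedding

variable {L' L : MaxMinLP} (φ : Embedding L' L)

/-- The action of an embedding on the nodes of the communication graph. -/
def onNode : L'.Node → L.Node
  | .agent v => .agent (φ.onV v)
  | .con i => .con (φ.onI i)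
  | .obj k => .obj (φ.onK k)

theorem onNode_injective : Function.Injective φ.onNode := by
  intro s t h
  cases s <;> cases t <;> simp only [onNode, Node.agent.injEq, Node.con.injEq, Node.obj.injEq,
    reduceCtorEq] at h ⊢
  · exact φ.onV_injective h
  · exact φ.onI_injective h
  · exact φ.onK_injective h

theorem adj_iff (s t : L'.Node) :
    L.graph.Adj (φ.onNode s) (φ.onNode t) ↔ L'.graph.Adj s t := by
  cases s <;> cases t <;> simp [onNode, graph, φ.conEdge_iff, φ.objEdge_iff]

theorem mem_ball_of_mem_ball {s t : L'.Node} {n : ℕ} (h : t ∈ L'.ball s n) :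
    φ.onNode t ∈ L.ball (φ.onNode s) n := by
  induction n generalizing t with
  | zero => rw [mem_ball_zero] at h ⊢; rw [h]
  | succ n ih =>
    obtain ⟨u, hu, rfl | hut⟩ := mem_ball_succ.1 h
    · exact mem_ball_succ.2 ⟨_, ih hu, Or.inl rfl⟩
    · exact mem_ball_succ.2 ⟨_, ih hu, Or.inr ((φ.adj_iff _ _).2 hut)⟩

/-- A shortest path to a node of the ball stays inside the ball, hence in the image; the image is
induced, so the path lifts. -/
theorem ball_subset_image {s : L'.Node} {n : ℕ}
    (h : L.ball (φ.onNode s) n ⊆ Set.range φ.onNode) :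
    L.ball (φ.onNode s) n ⊆ φ.onNode '' L'.ball s n := by
  induction n with
  | zero =>
    intro t ht
    exact ⟨s, mem_ball_zero.2 rfl, mem_ball_zero.1 ht⟩
  | succ n ih =>
    intro t ht
    obtain ⟨t, rfl⟩ := h ht
    obtain ⟨u, hu, hut⟩ := mem_ball_succ.1 ht
    obtain ⟨u', hu', rfl⟩ := ih ((ball_mono _ n.le_succ).trans h) hu
    refine ⟨t, mem_ball_succ.2 ⟨u', hu', ?_⟩, rfl⟩
    exact hut.imp (fun h => φ.onNode_injective h) (φ.adj_iff _ _).1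

variable (ident : L.Node → ℕ) (hident : Function.Injective ident)

/-- The rank labelling pulled back along an embedding. -/
noncomputable def pullback : L'.Labelling :=
  rankLabelling L' (ident ∘ φ.onNode) (hident.comp φ.onNode_injective)

theorem port_pullback {s : L'.Node}
    (hs : L.graph.neighborSet (φ.onNode s) ⊆ Set.range φ.onNode) (t : L'.Node) :
    (φ.pullback ident hident).port s t =
      (rankLabelling L ident hident).port (φ.onNode s) (φ.onNode t) := by
  simp only [pullback, rankLabelling, Function.comp]
  rw [← Set.ncard_image_of_injective _ φ.onNode_injective]
  congr 1
  ext u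
  constructor
  · rintro ⟨u, hu, rfl⟩
    exact ⟨(φ.adj_iff _ _).2 hu.1, hu.2⟩
  · rintro ⟨hu, hut⟩
    obtain ⟨u, rfl⟩ := hs hu
    exact ⟨u, ⟨(φ.adj_iff _ _).1 hu, hut⟩, rfl⟩

theorem localInput_pullback {s : L'.Node}
    (hs : L.graph.neighborSet (φ.onNode s) ⊆ Set.range φ.onNode) :
    (φ.pullback ident hident).localInput s =
      (rankLabelling L ident hident).localInput (φ.onNode s) := by
  have hport := φ.port_pullback ident hident hs
  have hid : ∀ t, (φ.pullback ident hident).ident t =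
    (rankLabelling L ident hident).ident (φ.onNode t) := fun _ => rfl
  cases s with
  | agent v =>
    simp only [onNode] at hs
    simp only [Labelling.localInput, onNode, LocalInput.agent.injEq]
    constructor
    · ext p
      constructor
      · rintro ⟨i, hi, rfl⟩
        refine ⟨φ.onI i, (φ.conEdge_iff _ _).2 hi, ?_⟩
        rw [hport, hid, φ.a_eq]; rfl
      · rintro ⟨i, hi, rfl⟩
        obtain ⟨t, ht⟩ := hs (a := .con i) hi
        cases t with
        | con j =>
          obtain rfl : φ.onI j = i := by simpa [onNode] using ht
          refine ⟨j, (φ.conEdge_iff _ _).1 hi, ?_⟩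
          rw [hport, hid, φ.a_eq]; rfl
        | _ => simp [onNode] at ht
    · ext p
      constructor
      · rintro ⟨i, hi, rfl⟩
        refine ⟨φ.onK i, (φ.objEdge_iff _ _).2 hi, ?_⟩
        rw [hport, hid, φ.c_eq]; rfl
      · rintro ⟨i, hi, rfl⟩
        obtain ⟨t, ht⟩ := hs (a := .obj i) hi
        cases t with
        | obj j =>
          obtain rfl : φ.onK j = i := by simpa [onNode] using ht
          refine ⟨j, (φ.objEdge_iff _ _).1 hi, ?_⟩
          rw [hport, hid, φ.c_eq]; rfl
        | _ => simp [onNode] at ht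
  | con i =>
    simp only [onNode] at hs
    simp only [Labelling.localInput, onNode, LocalInput.con.injEq]
    ext p
    constructor
    · rintro ⟨v, hv, rfl⟩
      refine ⟨φ.onV v, (φ.conEdge_iff _ _).2 hv, ?_⟩
      rw [hport, hid]; rfl
    · rintro ⟨v, hv, rfl⟩
      obtain ⟨t, ht⟩ := hs (a := .agent v) hv
      cases t with
      | agent u =>
        obtain rfl : φ.onV u = v := by simpa [onNode] using ht
        refine ⟨u, (φ.conEdge_iff _ _).1 hv, ?_⟩
        rw [hport, hid]; rfl
      | _ => simp [onNode] at ht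
  | obj k =>
    simp only [onNode] at hs
    simp only [Labelling.localInput, onNode, LocalInput.obj.injEq]
    ext p
    constructor
    · rintro ⟨v, hv, rfl⟩
      refine ⟨φ.onV v, (φ.objEdge_iff _ _).2 hv, ?_⟩
      rw [hport, hid]; rfl
    · rintro ⟨v, hv, rfl⟩
      obtain ⟨t, ht⟩ := hs (a := .agent v) hv
      cases t with
      | agent u =>
        obtain rfl : φ.onV u = v := by simpa [onNode] using ht
        refine ⟨u, (φ.objEdge_iff _ _).1 hv, ?_⟩
        rw [hport, hid]; rfl
      | _ => simp [onNode] at ht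

/-- A local rule cannot distinguish an LP from a sub-LP that contains the whole neighbourhood
of the agent. -/
theorem output_pullback {v : L'.V} {r : ℕ}
    (h : L.ball (.agent (φ.onV v)) (r + 1) ⊆ Set.range φ.onNode) (A : LocalRule) :
    (φ.pullback ident hident).output A r v =
      (rankLabelling L ident hident).output A r (φ.onV v) := by
  have himage : φ.onNode '' L'.ball (.agent v) r = L.ball (.agent (φ.onV v)) r := by
    apply Set.Subset.antisymm
    · rintro _ ⟨t, ht, rfl⟩
      exact φ.mem_ball_of_mem_ball ht
    · exact φ.ball_subset_image (s := .agent v) ((ball_mono _ r.le_succ).trans h)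
  have hview : (φ.pullback ident hident).view v r =
      (rankLabelling L ident hident).view (φ.onV v) r := by
    simp only [Labelling.view, ← himage, Set.image_image]
    refine Set.image_congr fun t ht => ?_
    -- The local input of a node at distance `r` mentions its neighbours, whence the radius `r + 1`
    -- in the hypothesis.
    refine Prod.ext rfl (φ.localInput_pullback ident hident fun u hu => h ?_)
    exact mem_ball_succ.2 ⟨_, φ.mem_ball_of_mem_ball ht, Or.inr hu⟩
  simp only [Labelling.output, hview]
  rfl

end Embedding

/-! ### Growth of reachable sets of agents -/

section Reach

variable {V I K : Type} (con : V → I) (obj : V → K)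

/-- The agents that can be reached from `v` by `t` steps between agents that share a constraint or
an objective. -/
def reach (v : V) : ℕ → Set V
  | 0 => {v}
  | t + 1 => {p | ∃ p₀ ∈ reach v t, con p₀ = con p ∨ obj p₀ = obj p}

theorem reach_subset_succ (v : V) (t : ℕ) : reach con obj v t ⊆ reach con obj v (t + 1) :=
  fun p hp => ⟨p, hp, Or.inl rfl⟩

theorem reach_mono (v : V) : Monotone (reach con obj v) :=
  monotone_nat_of_le_succ (reach_subset_succ con obj v)

/-- A layer depends only on the previous one, so a stationary step would make the sequence constant.
As long as it moves, each step adds an agent. -/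
theorem lt_ncard_reach [Finite V] {v : V} {t : ℕ}
    (h : reach con obj v (t + 1) ≠ reach con obj v t) :
    t < (reach con obj v t).ncard := by
  induction t with
  | zero => simp [reach]
  | succ t ih =>
    have hne : reach con obj v (t + 1) ≠ reach con obj v t := by
      intro heq
      apply h
      change {p | ∃ p₀ ∈ reach con obj v (t + 1), _} = {p | ∃ p₀ ∈ reach con obj v t, _}
      rw [heq]
    have hlt := Set.ncard_lt_ncard
      ((reach_subset_succ con obj v t).ssubset_of_ne hne.symm) (Set.toFinite _)
    have := ih hne
    omega

end Reach

/-! ### Bipartite LPs with unit coefficients -/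

section OfMaps

variable {V I K : Type} [Fintype V] [Fintype I] [Fintype K] (con : V → I) (obj : V → K)

/-- The max-min LP with unit coefficients in which `con v` is the only constraint and `obj v` the
only objective of the agent `v`. -/
abbrev ofMaps : MaxMinLP where
  V := V
  I := I
  K := K
  conEdge i v := con v = i
  objEdge k v := obj v = k
  a _ _ := 1
  c _ _ := 1
  a_nonneg _ _ _ := zero_le_one
  c_nonneg _ _ _ := zero_le_one

theorem isBipartite_ofMaps : (ofMaps con obj).IsBipartite :=
  fun v => ⟨⟨con v, rfl, fun _ h => h.symm⟩, ⟨obj v, rfl, fun _ h => h.symm⟩⟩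

theorem positiveCoefficients_ofMaps : (ofMaps con obj).PositiveCoefficients :=
  ⟨fun _ _ _ => zero_lt_one, fun _ _ _ => zero_lt_one⟩

open Classical in
theorem conValue_ofMaps (x : V → ℝ) (i : I) :
    (ofMaps con obj).conValue x i = ∑ v with con v = i, x v := by
  simp only [conValue, conAgents, one_mul]

open Classical in
theorem objValue_ofMaps (x : V → ℝ) (k : K) :
    (ofMaps con obj).objValue x k = ∑ v with obj v = k, x v := by
  simp only [objValue, objAgents, one_mul]

/-- The fibres of `obj` and those of `con` both partition the agents, so both sides are the sum of
all `x v`. -/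
theorem sum_objValue_eq_sum_conValue (x : V → ℝ) :
    ∑ k, (ofMaps con obj).objValue x k = ∑ i, (ofMaps con obj).conValue x i := by
  classical
  simp only [conValue_ofMaps, objValue_ofMaps]
  exact (Finset.sum_fiberwise _ obj x).trans (Finset.sum_fiberwise _ con x).symm

theorem agent_mem_ball_iff (v u : V) (r : ℕ) :
    Node.agent u ∈ (ofMaps con obj).ball (Node.agent v) r ↔ u ∈ reach con obj v (r / 2) := by
  constructor
  -- The induction has to cover all nodes. Constraints and objectives lie at odd distance, hence `(r
  -- - 1) / 2`; the conjunct `1 ≤ r` keeps the truncated subtraction honest.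
  · have key : ∀ t ∈ (ofMaps con obj).ball (Node.agent v) r,
        match t with
        | .agent u => u ∈ reach con obj v (r / 2)
        | .con i => 1 ≤ r ∧ ∃ p ∈ reach con obj v ((r - 1) / 2), con p = i
        | .obj k => 1 ≤ r ∧ ∃ p ∈ reach con obj v ((r - 1) / 2), obj p = k := by
      induction r with
      | zero =>
        intro t ht
        obtain rfl := mem_ball_zero.1 ht
        simp [reach]
      | succ r ih =>
        intro t ht
        obtain ⟨s, hs, hst⟩ := mem_ball_succ.1 ht
        have hs' := ih s hs
        rcases hst with rfl | hadj
        · cases s with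
          | agent u => exact reach_mono con obj v (by omega) hs'
          | con i =>
            obtain ⟨_, p, hp, hpi⟩ := hs'
            exact ⟨by omega, p, reach_mono con obj v (by omega) hp, hpi⟩
          | obj k =>
            obtain ⟨_, p, hp, hpi⟩ := hs'
            exact ⟨by omega, p, reach_mono con obj v (by omega) hp, hpi⟩
        · cases s with
          | agent p =>
            cases t with
            | agent u => exact hadj.elim
            | con i => exact ⟨by omega, p, hs', hadj⟩
            | obj k => exact ⟨by omega, p, hs', hadj⟩
          | con i =>
            obtain ⟨hr, p, hp, hpi⟩ := hs'
            cases t with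
            | agent u =>
              have : (r + 1) / 2 = (r - 1) / 2 + 1 := by omega
              simp only [this]
              exact ⟨p, hp, Or.inl (hpi.trans (Eq.symm hadj))⟩
            | con i => exact hadj.elim
            | obj k => exact hadj.elim
          | obj k =>
            obtain ⟨hr, p, hp, hpi⟩ := hs'
            cases t with
            | agent u =>
              have : (r + 1) / 2 = (r - 1) / 2 + 1 := by omega
              simp only [this]
              exact ⟨p, hp, Or.inr (hpi.trans (Eq.symm hadj))⟩
            | con i => exact hadj.elim
            | obj k => exact hadj.elim
    exact key (.agent u)
  · have key : ∀ t, ∀ u ∈ reach con obj v t,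
        Node.agent u ∈ (ofMaps con obj).ball (Node.agent v) (2 * t) := by
      intro t
      induction t with
      | zero =>
        rintro u rfl
        exact mem_ball_zero.2 rfl
      | succ t ih =>
        rintro u ⟨p, hp, h | h⟩
        · exact mem_ball_succ.2 ⟨.con (con p),
            mem_ball_succ.2 ⟨_, ih p hp, Or.inr rfl⟩, Or.inr h.symm⟩
        · exact mem_ball_succ.2 ⟨.obj (obj p),
            mem_ball_succ.2 ⟨_, ih p hp, Or.inr rfl⟩, Or.inr h.symm⟩
    exact fun h => ball_mono _ (by omega) (key _ u h)

theorem ballAgentCount_ofMaps (v : V) (r : ℕ) :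
    (ofMaps con obj).ballAgentCount v r = (reach con obj v (r / 2)).ncard := by
  simp only [ballAgentCount, agent_mem_ball_iff]
  rfl

end OfMaps

/-! ### Subdivided multigraphs and their growth -/

section Subdivision

variable {U E : Type} (ends : E → Bool → U) (n : ℕ)

/-- The constraint of an agent in the subdivision of the multigraph `ends`, where each edge `e` is
replaced by a path of `2 * n + 2` agents. -/
def subdivCon (p : E × Fin (2 * n + 2)) : U ⊕ (E × Fin n) :=
  if _h0 : p.2.1 = 0 then .inl (ends p.1 false)
  else if _h1 : p.2.1 = 2 * n + 1 then .inl (ends p.1 true)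
  -- Inner constraint `j` joins positions `2j+1` and `2j+2`, while objective `j` joins `2j` and
  -- `2j+1`; together they link the agents into a path.
  else .inr (p.1, ⟨(p.2.1 - 1) / 2, by omega⟩)

/-- The objective of an agent in the subdivision of a multigraph. -/
def subdivObj (p : E × Fin (2 * n + 2)) : E × Fin (n + 1) :=
  (p.1, ⟨p.2.1 / 2, by omega⟩)

/-- The max-min LP of a subdivided multigraph. -/
abbrev subdivision [Fintype U] [Fintype E] : MaxMinLP :=
  ofMaps (subdivCon ends n) (subdivObj (E := E) n)

/-- The extreme agents of the path that replaces the edge `e`. -/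
def endAgent (e : E) (b : Bool) : E × Fin (2 * n + 2) := (e, if b then Fin.last _ else 0)

/-- `Toward b q q'` says that `q'` lies weakly on the side of the end `b` of `q`. -/
def Toward (b : Bool) (q q' : ℕ) : Prop := if b then q ≤ q' else q' ≤ q

/-- `Between q q' q''` says that `q''` lies weakly between `q` and `q'`. -/
def Between (q q' q'' : ℕ) : Prop := (q ≤ q'' ∧ q'' ≤ q') ∨ (q' ≤ q'' ∧ q'' ≤ q)

variable {ends n}

theorem subdivCon_eq_inl {p : E × Fin (2 * n + 2)} {u : U} (h : subdivCon ends n p = .inl u) :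
    ∃ b, p = endAgent n p.1 b ∧ ends p.1 b = u := by
  obtain ⟨e, q, hq⟩ := p
  simp only [subdivCon] at h
  split_ifs at h with h0 h1
  · refine ⟨false, ?_, by simpa using h⟩
    simp [endAgent, h0]
  · refine ⟨true, ?_, by simpa using h⟩
    simp [endAgent, Fin.ext_iff, h1]

theorem subdivCon_eq_inr {p : E × Fin (2 * n + 2)} {e : E} {j : Fin n}
    (h : subdivCon ends n p = .inr (e, j)) :
    p.1 = e ∧ (p.2.1 = 2 * j + 1 ∨ p.2.1 = 2 * j + 2) := by
  obtain ⟨e', q, hq⟩ := p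
  simp only [subdivCon] at h
  split_ifs at h with h0 h1
  simp only [Sum.inr.injEq, Prod.mk.injEq, Fin.ext_iff] at h
  exact ⟨h.1, by simp only; omega⟩

theorem subdivObj_eq {p : E × Fin (2 * n + 2)} {e : E} {j : Fin (n + 1)}
    (h : subdivObj n p = (e, j)) : p.1 = e ∧ (p.2.1 = 2 * j ∨ p.2.1 = 2 * j + 1) := by
  simp only [subdivObj, Prod.mk.injEq, Fin.ext_iff] at h
  exact ⟨h.1, by omega⟩

theorem subdivision_step {p₀ p : E × Fin (2 * n + 2)}
    (h : subdivCon ends n p₀ = subdivCon ends n p ∨ subdivObj n p₀ = subdivObj n p) :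
    (p₀.1 = p.1 ∧ p₀.2.1 ≤ p.2.1 + 1 ∧ p.2.1 ≤ p₀.2.1 + 1) ∨
      ∃ b b₀, p = endAgent n p.1 b ∧ p₀ = endAgent n p₀.1 b₀ ∧ ends p₀.1 b₀ = ends p.1 b := by
  rcases h with h | h
  · rcases hp : subdivCon ends n p with u | ⟨e, j⟩
    · obtain ⟨b, hb, hbu⟩ := subdivCon_eq_inl hp
      obtain ⟨b₀, hb₀, hbu₀⟩ := subdivCon_eq_inl (h.trans hp)
      exact Or.inr ⟨b, b₀, hb, hb₀, hbu₀.trans hbu.symm⟩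
    · obtain ⟨h1, h2⟩ := subdivCon_eq_inr hp
      obtain ⟨h3, h4⟩ := subdivCon_eq_inr (h.trans hp)
      exact Or.inl ⟨h3.trans h1.symm, by omega, by omega⟩
  · rcases hp : subdivObj n p with ⟨e, j⟩
    obtain ⟨h1, h2⟩ := subdivObj_eq hp
    obtain ⟨h3, h4⟩ := subdivObj_eq (h.trans hp)
    exact Or.inl ⟨h3.trans h1.symm, by omega, by omega⟩

variable (ends n) in
/-- The agents within `t` steps of `v` in the subdivision. -/
abbrev subdivReach (v : E × Fin (2 * n + 2)) (t : ℕ) : Set (E × Fin (2 * n + 2)) :=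
  reach (subdivCon ends n) (subdivObj n) v t

theorem toward_endAgent_eq {b : Bool} {e : E} {q : Fin (2 * n + 2)}
    (h : Toward b (endAgent n e b).2 q) : q = (endAgent n e b).2 := by
  rw [Fin.ext_iff]
  cases b <;> simp only [Toward, endAgent, Bool.false_eq_true, if_true, if_false, Fin.val_last,
    Fin.val_zero] at h ⊢ <;> omega

theorem toward_not_endAgent (b : Bool) (e : E) (q : Fin (2 * n + 2)) :
    Toward (!b) (endAgent n e b).2 q := by
  cases b <;> simp only [Toward, endAgent, Bool.false_eq_true, if_true, if_false, Fin.val_last,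
    Fin.val_zero, Bool.not_true, Bool.not_false] <;> omega

/-- An agent reached in `t + 1` steps was reached along its path, either from `v` or from one of
the ends of the path. -/
theorem reach_succ_structure {v : E × Fin (2 * n + 2)} {t : ℕ}
    (ih : ∀ p ∈ subdivReach ends n v t,
      (p.1 = v.1 ∧ ∀ q : Fin (2 * n + 2), Between v.2 p.2 q → (p.1, q) ∈ subdivReach ends n v t) ∨
      ∃ b, (∀ q : Fin (2 * n + 2), Toward b p.2 q → (p.1, q) ∈ subdivReach ends n v t) ∧
        ∃ s < t, ∃ e' b', ends e' b' = ends p.1 b ∧ endAgent n e' b' ∈ subdivReach ends n v s)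
    {p : E × Fin (2 * n + 2)} (hp : p ∈ subdivReach ends n v (t + 1)) :
    (p.1 = v.1 ∧ ∀ q : Fin (2 * n + 2), Between v.2 p.2 q → q ≠ p.2 →
      (p.1, q) ∈ subdivReach ends n v t) ∨
    ∃ b, (∀ q : Fin (2 * n + 2), Toward b p.2 q → q ≠ p.2 → (p.1, q) ∈ subdivReach ends n v t) ∧
      ∃ e' b', ends e' b' = ends p.1 b ∧ endAgent n e' b' ∈ subdivReach ends n v t := by
  obtain ⟨p₀, hp₀, hstep⟩ := hp
  rcases subdivision_step hstep with ⟨h1, h2, h3⟩ | ⟨b, b₀, hb, hb₀, hbb⟩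
  · rcases ih p₀ hp₀ with ⟨hv, hbet⟩ | ⟨b, htow, s, hs, e', b', he', hreach⟩
    · refine Or.inl ⟨h1 ▸ hv, fun q hq hne => h1 ▸ hbet q ?_⟩
      rw [Ne, Fin.ext_iff] at hne
      simp only [Between] at hq ⊢
      omega
    · refine Or.inr ⟨b, fun q hq hne => h1 ▸ htow q ?_, e', b', h1 ▸ he',
        reach_mono _ _ v hs.le hreach⟩
      rw [Ne, Fin.ext_iff] at hne
      cases b <;> simp [Toward] at hq ⊢ <;> omega
  · refine Or.inr ⟨b, fun q hq hne => ?_, p₀.1, b₀, hbb, hb₀ ▸ hp₀⟩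
    rw [hb] at hq hne
    exact absurd (toward_endAgent_eq hq) hne

/-- The explored part of a path has no gaps: it grows outwards from `v` or inwards from an end. The
strict `s < t` records that this end was touched earlier, which drives the first-arrival argument in
`card_touched_le`. -/
theorem reach_structure (v : E × Fin (2 * n + 2)) (t : ℕ) :
    ∀ p ∈ subdivReach ends n v t,
      (p.1 = v.1 ∧ ∀ q : Fin (2 * n + 2), Between v.2 p.2 q → (p.1, q) ∈ subdivReach ends n v t) ∨
      ∃ b, (∀ q : Fin (2 * n + 2), Toward b p.2 q → (p.1, q) ∈ subdivReach ends n v t) ∧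
        ∃ s < t, ∃ e' b', ends e' b' = ends p.1 b ∧
          endAgent n e' b' ∈ subdivReach ends n v s := by
  induction t with
  | zero =>
    rintro p rfl
    refine Or.inl ⟨rfl, fun q hq => ?_⟩
    have : q = p.2 := by
      simp only [Between] at hq
      omega
    subst this
    rfl
  | succ t ih =>
    intro p hp
    have hself : ∀ q : Fin (2 * n + 2), (q ≠ p.2 → (p.1, q) ∈ subdivReach ends n v t) →
        (p.1, q) ∈ subdivReach ends n v (t + 1) := by
      intro q hq
      by_cases h : q = p.2
      · rw [h]; exact hp
      · exact reach_subset_succ _ _ v t (hq h)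
    rcases reach_succ_structure ih hp with ⟨hv, hbet⟩ | ⟨b, htow, e', b', he', hreach⟩
    · exact Or.inl ⟨hv, fun q hq => hself q (hbet q hq)⟩
    · exact Or.inr ⟨b, fun q hq => hself q (htow q hq), t, t.lt_succ_self, e', b', he', hreach⟩

open Classical in
variable (ends n) in
/-- The branch vertices that are adjacent to an agent within `t` steps of `v`. -/
noncomputable def touched [Fintype U] (v : E × Fin (2 * n + 2)) (t : ℕ) : Finset U :=
  {u | ∃ e b, ends e b = u ∧ endAgent n e b ∈ subdivReach ends n v t}

open Classical in
variable (ends n) in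
/-- The edges all of whose agents are within `t` steps of `v`. -/
noncomputable def explored [Fintype E] (v : E × Fin (2 * n + 2)) (t : ℕ) : Finset E :=
  {e | ∀ q, (e, q) ∈ subdivReach ends n v t}

/-- Send each touched vertex to the edge through which it was first reached. Unless that is the edge
of `v`, it has been traversed from its other end and so is explored, and distinct vertices use
distinct edges. The edge of `v` accounts for its two ends. -/
theorem card_touched_le [Fintype U] [Fintype E] (v : E × Fin (2 * n + 2)) (t : ℕ) :
    (touched ends n v t).card ≤ (explored ends n v t).card + 2 := by
  classical
  have : Nonempty E := ⟨v.1⟩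
  have hfirst : ∀ u ∈ touched ends n v t, ∃ s ≤ t, ∃ e b, ends e b = u ∧
      endAgent n e b ∈ subdivReach ends n v s ∧
      ∀ s' e' b', ends e' b' = u → endAgent n e' b' ∈ subdivReach ends n v s' → s ≤ s' := by
    intro u hu
    simp only [touched, Finset.mem_filter, Finset.mem_univ, true_and] at hu
    have hex : ∃ s, ∃ e b, ends e b = u ∧ endAgent n e b ∈ subdivReach ends n v s := ⟨t, hu⟩
    obtain ⟨e, b, hu', hr⟩ := Nat.find_spec hex
    exact ⟨Nat.find hex, Nat.find_min' hex hu, e, b, hu', hr,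
      fun s' e' b' h1 h2 => Nat.find_min' hex ⟨e', b', h1, h2⟩⟩
  choose! s hst e b hend hreach hmin using hfirst
  have hkey : ∀ u ∈ touched ends n v t, e u ≠ v.1 → e u ∈ explored ends n v t ∧
      ∃ s' < s u, ∃ e' b', ends e' b' = ends (e u) (!(b u)) ∧
        endAgent n e' b' ∈ subdivReach ends n v s' := by
    intro u hu hne
    rcases reach_structure v (s u) _ (hreach u hu) with ⟨hv, -⟩ | ⟨c, htow, s', hs', e', b', he', hr⟩
    · exact absurd hv hne
    -- The path was not entered from the end at `u` itself, since then `u` would have been touched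
    -- before its first time.
    · have hc : c = !(b u) := by
        by_contra hc
        have hc' : c = b u := by cases c <;> cases h : b u <;> simp_all
        have := hmin u hu s' e' b' (he'.trans (by rw [hc']; exact hend u hu)) hr
        omega
      subst hc
      refine ⟨?_, s', hs', e', b', he', hr⟩
      simp only [explored, Finset.mem_filter, Finset.mem_univ, true_and]
      exact fun q => reach_mono _ _ v (hst u hu) (htow q (toward_not_endAgent _ _ _))
  have hinj : Set.InjOn e {u | u ∈ touched ends n v t ∧ e u ≠ v.1} := by
    rintro u ⟨hu, hne⟩ u' ⟨hu', hne'⟩ heq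
    by_contra huu
    -- Two vertices first reached through the same edge are its opposite ends, and each would have
    -- been touched strictly before the other.
    have hb : b u' = !(b u) := by
      by_contra hb
      have hb' : b u' = b u := by cases h : b u <;> cases h' : b u' <;> simp_all
      apply huu
      rw [← hend u hu, ← hend u' hu', heq, hb']
    obtain ⟨-, s₁, hs₁, e₁, b₁, h₁, hr₁⟩ := hkey u hu hne
    obtain ⟨-, s₂, hs₂, e₂, b₂, h₂, hr₂⟩ := hkey u' hu' hne'
    rw [← hb, heq, hend u' hu'] at h₁
    rw [hb, Bool.not_not, ← heq, hend u hu] at h₂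
    have := hmin u' hu' s₁ e₁ b₁ h₁ hr₁
    have := hmin u hu s₂ e₂ b₂ h₂ hr₂
    omega
  have hsub : touched ends n v t ⊆
      (touched ends n v t).filter (fun u => e u ≠ v.1) ∪ {ends v.1 false, ends v.1 true} := by
    intro u hu
    by_cases hne : e u = v.1
    · have := hend u hu
      rw [hne] at this
      cases hb : b u <;> rw [hb] at this <;> simp [this]
    · simp [hu, hne]
  refine (Finset.card_le_card hsub).trans ((Finset.card_union_le _ _).trans ?_)
  refine add_le_add ?_ Finset.card_le_two
  refine Finset.card_le_card_of_injOn e (fun u hu => ?_) (fun u hu u' hu' => ?_)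
  · simp only [Finset.coe_filter, Set.mem_ofPred_eq] at hu
    exact (hkey u hu.1 hu.2).1
  · simp only [Finset.coe_filter] at hu hu'
    exact hinj hu hu'

/-- Every vertex of the multigraph has degree at most `d`. -/
def MaxDegreeLE (ends : E → Bool → U) (d : ℕ) : Prop :=
  ∀ u, {h : E × Bool | ends h.1 h.2 = u}.ncard ≤ d

theorem card_half_edges_le [Fintype E] (hdeg : MaxDegreeLE ends 3) (s : Finset U) :
    {h : E × Bool | ends h.1 h.2 ∈ s}.ncard ≤ 3 * s.card := by
  classical
  rw [Set.ncard_eq_toFinset_card']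
  refine Finset.card_le_mul_card_image_of_maps_to (f := fun h : E × Bool => ends h.1 h.2)
    (fun h hh => by simpa using hh) 3 fun u _ => ?_
  refine le_trans ?_ (hdeg u)
  rw [Set.ncard_eq_toFinset_card']
  refine Finset.card_le_card fun h hh => ?_
  simp only [Finset.mem_filter] at hh
  simpa using hh.2

/-- A new agent is the frontier either of a half-edge at a touched vertex whose edge is not yet
explored, or of one of the two directions from `v`. With `T` touched vertices and `X` explored edges
this gives at most `3T - 2X + 2` agents, and `T ≤ X + 2`. -/
theorem card_sphere_le [Fintype U] [Fintype E] (hdeg : MaxDegreeLE ends 3)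
    (v : E × Fin (2 * n + 2)) (t : ℕ) :
    (subdivReach ends n v (t + 1) \ subdivReach ends n v t).ncard ≤
      (explored ends n v t).card + 8 := by
  classical
  set N := (subdivReach ends n v (t + 1) \ subdivReach ends n v t).toFinset with hN
  set H := {h : E × Bool | ends h.1 h.2 ∈ touched ends n v t}.toFinset with hH
  set F := explored ends n v t ×ˢ (Finset.univ : Finset Bool) with hF
  have hFH : F ⊆ H := by
    rintro ⟨e, b⟩ h
    simp only [hF, Finset.mem_product, Finset.mem_univ, and_true, explored, Finset.mem_filter,
      true_and] at h
    simp only [hH, Set.mem_toFinset, Set.mem_ofPred_eq, touched, Finset.mem_filter, Finset.mem_univ,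
      true_and]
    exact ⟨e, b, rfl, h _⟩
  have hHcard : H.card ≤ 3 * (touched ends n v t).card := by
    rw [hH, ← Set.ncard_eq_toFinset_card']
    exact card_half_edges_le hdeg _
  have hFcard : F.card = (explored ends n v t).card * 2 := by
    rw [hF, Finset.card_product, Finset.card_univ, Fintype.card_bool]
  -- Each frontier label carries at most one new agent: of two on the same ray, the nearer one would
  -- already be reached.
  have hNcard : N.card ≤ ((H \ F).disjSum (Finset.univ : Finset Bool)).card := by
    refine Finset.card_le_card_of_forall_subsingleton
      (fun p h => match h with
        | .inl (e, b) => p.1 = e ∧ ∀ q : Fin (2 * n + 2), Toward b p.2 q → q ≠ p.2 →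
            (p.1, q) ∈ subdivReach ends n v t
        | .inr d => p.1 = v.1 ∧ (d = true ↔ v.2.1 ≤ p.2.1) ∧
            ∀ q : Fin (2 * n + 2), Between v.2 p.2 q → q ≠ p.2 →
              (p.1, q) ∈ subdivReach ends n v t) ?_ ?_
    · intro p hp
      simp only [hN, Set.mem_toFinset] at hp
      rcases reach_succ_structure (reach_structure v t) hp.1 with
        ⟨hv, hbet⟩ | ⟨b, htow, e', b', he', hreach⟩
      · exact ⟨.inr (decide (v.2.1 ≤ p.2.1)), Finset.inr_mem_disjSum.2 (Finset.mem_univ _), hv,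
          decide_eq_true_iff, hbet⟩
      · refine ⟨.inl (p.1, b), ?_, rfl, htow⟩
        simp only [Finset.inl_mem_disjSum, Finset.mem_sdiff]
        constructor
        · simp only [hH, Set.mem_toFinset, Set.mem_ofPred_eq, touched, Finset.mem_filter,
            Finset.mem_univ, true_and]
          exact ⟨e', b', he', hreach⟩
        · simp only [hF, Finset.mem_product, Finset.mem_univ, and_true, explored,
            Finset.mem_filter, true_and]
          exact fun h => hp.2 (h p.2)
    · rintro (⟨e, b⟩ | d) -
      · rintro p ⟨hp, hpe, hpt⟩ p' ⟨hp', hpe', hpt'⟩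
        simp only [hN, Set.mem_toFinset] at hp hp'
        have heq : p.1 = p'.1 := hpe.trans hpe'.symm
        by_contra hne
        have hq : p.2 ≠ p'.2 := fun h => hne (Prod.ext heq h)
        have htot : Toward b p.2 p'.2 ∨ Toward b p'.2 p.2 := by
          cases b <;> simp [Toward] <;> omega
        rcases htot with h | h
        · exact hp'.2 (by have := hpt _ h hq.symm; rwa [heq] at this)
        · exact hp.2 (by have := hpt' _ h hq; rwa [← heq] at this)
      · rintro p ⟨hp, hpe, hpd, hpt⟩ p' ⟨hp', hpe', hpd', hpt'⟩
        simp only [hN, Set.mem_toFinset] at hp hp'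
        have heq : p.1 = p'.1 := hpe.trans hpe'.symm
        by_contra hne
        have hq : p.2 ≠ p'.2 := fun h => hne (Prod.ext heq h)
        have hside := hpd.symm.trans hpd'
        have htot : Between v.2 p.2 p'.2 ∨ Between v.2 p'.2 p.2 := by
          simp only [Between]
          omega
        rcases htot with h | h
        · exact hp'.2 (by have := hpt _ h hq.symm; rwa [heq] at this)
        · exact hp.2 (by have := hpt' _ h hq; rwa [← heq] at this)
  rw [Finset.card_disjSum, Finset.card_sdiff_of_subset hFH, Finset.card_univ,
    Fintype.card_bool] at hNcard
  have hN' : (subdivReach ends n v (t + 1) \ subdivReach ends n v t).ncard = N.card :=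
    Set.ncard_eq_toFinset_card' _
  have := card_touched_le (ends := ends) v t
  omega

theorem mul_card_explored_le [Fintype E] (v : E × Fin (2 * n + 2)) (t : ℕ) :
    (2 * n + 2) * (explored ends n v t).card ≤ (subdivReach ends n v t).ncard := by
  classical
  have : (explored ends n v t ×ˢ (Finset.univ : Finset (Fin (2 * n + 2)))).card =
      (2 * n + 2) * (explored ends n v t).card := by
    rw [Finset.card_product, Finset.card_univ, Fintype.card_fin, mul_comm]
  rw [← this, ← Set.ncard_coe_finset]
  refine Set.ncard_le_ncard ?_ (Set.toFinite _)
  rintro ⟨e, q⟩ h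
  simp only [explored, Finset.coe_product, Set.mem_prod, Finset.mem_coe, Finset.mem_filter,
    Finset.mem_univ, true_and, and_true, Finset.coe_univ, Set.mem_univ] at h
  exact h q

/-- Subdivisions of multigraphs of maximum degree three have bounded relative growth, beyond a
radius that does not depend on the multigraph. -/
theorem boundedRelativeGrowth_subdivision [Fintype U] [Fintype E] (hdeg : MaxDegreeLE ends 3)
    {δ : ℝ} {R : ℕ} (hδ : 0 ≤ δ) (hR : 16 ≤ (δ - 1 / (2 * n + 2)) * R) :
    (subdivision ends n).BoundedRelativeGrowth δ R := by
  intro v r hr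
  rw [ballAgentCount_ofMaps, ballAgentCount_ofMaps, show (r + 2) / 2 = r / 2 + 1 by omega]
  set t := r / 2 with ht
  have hsub : subdivReach ends n v t ⊆ subdivReach ends n v (t + 1) := reach_subset_succ _ _ v t
  have hpos : 0 < (subdivReach ends n v t).ncard :=
    (Set.ncard_pos (Set.toFinite _)).2 ⟨v, reach_mono _ _ v (Nat.zero_le t) rfl⟩
  have hposR : (0 : ℝ) < (subdivReach ends n v t).ncard := by exact_mod_cast hpos
  rw [div_le_iff₀ hposR]
  by_cases hne : subdivReach ends n v (t + 1) = subdivReach ends n v t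
  · have : reach (subdivCon ends n) (subdivObj n) v (t + 1) = subdivReach ends n v t := hne
    rw [this]
    nlinarith
  have hlt : (t : ℝ) + 1 ≤ (subdivReach ends n v t).ncard := by
    exact_mod_cast lt_ncard_reach _ _ hne
  have hRt : (R : ℝ) ≤ 2 * (t + 1) := by
    have : R ≤ 2 * (t + 1) := by omega
    exact_mod_cast this
  have hN : ((subdivReach ends n v (t + 1)).ncard : ℝ) ≤
      (subdivReach ends n v t).ncard + ((explored ends n v t).card + 8) := by
    have h1 := card_sphere_le hdeg v t
    have h2 := Set.ncard_sdiff_add_ncard_of_subset hsub (Set.toFinite _)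
    have h3 : (subdivReach ends n v (t + 1)).ncard ≤
      (subdivReach ends n v t).ncard + ((explored ends n v t).card + 8) := by omega
    exact_mod_cast h3
  have hE : (2 * n + 2 : ℝ) * (explored ends n v t).card ≤ (subdivReach ends n v t).ncard := by
    exact_mod_cast mul_card_explored_le v t
  have hn : (0 : ℝ) < 2 * n + 2 := by positivity
  have hE' : ((explored ends n v t).card : ℝ) ≤
      1 / (2 * n + 2) * (subdivReach ends n v t).ncard := by
    rw [one_div, inv_mul_eq_div, le_div_iff₀ hn]
    linarith
  have hδn : 0 ≤ δ - 1 / (2 * n + 2) := by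
    by_contra hneg
    have : (0 : ℝ) ≤ R := by positivity
    nlinarith
  -- Combined with `hR`, this shows that the additive 8 is at most `(δ - 1 / (2n+2))` times the
  -- number of agents reached.
  have : (δ - 1 / (2 * n + 2)) * R ≤
      (δ - 1 / (2 * n + 2)) * (2 * (subdivReach ends n v t).ncard) :=
    mul_le_mul_of_nonneg_left (by linarith) hδn
  have h4 : ((reach (subdivCon ends n) (subdivObj n) v (t + 1)).ncard : ℝ) ≤
    (subdivReach ends n v t).ncard + ((explored ends n v t).card + 8) := hN
  linarith

end Subdivision

/-! ### Optimum and averaging bound for subdivisions -/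

section SubdivisionValues

variable {U E : Type} [Fintype U] [Fintype E] {ends : E → Bool → U} {n : ℕ}

open Classical in
theorem objAgents_subdivision (e : E) (j : Fin (n + 1)) :
    (subdivision ends n).objAgents (e, j) =
      ({(e, ⟨2 * j, by omega⟩), (e, ⟨2 * j + 1, by omega⟩)} : Finset (E × Fin (2 * n + 2))) := by
  ext ⟨e', q⟩
  simp only [objAgents, Finset.mem_filter, Finset.mem_univ, true_and, Finset.mem_insert,
    Finset.mem_singleton, subdivObj, Prod.mk.injEq, Fin.ext_iff]
  constructor
  · rintro ⟨rfl, h⟩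
    rcases Nat.mod_two_eq_zero_or_one q with h' | h'
    · exact Or.inl ⟨rfl, by omega⟩
    · exact Or.inr ⟨rfl, by omega⟩
  · rintro (⟨rfl, h⟩ | ⟨rfl, h⟩) <;> exact ⟨rfl, by omega⟩

theorem objValue_subdivision (x : E × Fin (2 * n + 2) → ℝ) (e : E) (j : Fin (n + 1)) :
    (subdivision ends n).objValue x (e, j) =
      x (e, ⟨2 * j, by omega⟩) + x (e, ⟨2 * j + 1, by omega⟩) := by
  classical
  simp only [objValue, objAgents_subdivision, one_mul]
  exact Finset.sum_pair (by simp)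

theorem degreeBounded_subdivision (hdeg : MaxDegreeLE ends 3) {ΔI ΔK : ℕ} (hI : 3 ≤ ΔI)
    (hK : 2 ≤ ΔK) : (subdivision ends n).DegreeBounded ΔI ΔK := by
  classical
  constructor
  · rintro (u | ⟨e, j⟩)
    · refine le_trans ?_ ((hdeg u).trans hI)
      rw [Set.ncard_eq_toFinset_card']
      refine le_trans (Finset.card_le_card ?_)
        (Finset.card_image_le (f := fun h : E × Bool => endAgent n h.1 h.2))
      intro p hp
      simp only [conAgents, Finset.mem_filter, Finset.mem_univ, true_and] at hp
      obtain ⟨b, hb, hbu⟩ := subdivCon_eq_inl hp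
      exact Finset.mem_image.2 ⟨(p.1, b), by simpa using hbu, hb.symm⟩
    · refine le_trans (Finset.card_le_card (t := {(e, ⟨2 * j + 1, by omega⟩),
        (e, ⟨2 * j + 2, by omega⟩)}) ?_) (Finset.card_le_two.trans (by omega))
      intro p hp
      simp only [conAgents, Finset.mem_filter, Finset.mem_univ, true_and] at hp
      obtain ⟨h1, h2⟩ := subdivCon_eq_inr hp
      simpa [Prod.ext_iff, Fin.ext_iff, h1] using h2
  · rintro ⟨e, j⟩
    rw [objAgents_subdivision]
    exact Finset.card_le_two.trans hK

/-- If each edge can be assigned to one of its ends so that no vertex is used twice, then the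
optimum of the subdivision is at least one. -/
theorem one_le_opt_subdivision (β : E → Bool)
    (hβ : Function.Injective fun e => ends e (β e)) : 1 ≤ (subdivision ends n).opt := by
  classical
  -- Activating every second agent hits each objective and each inner constraint exactly once. The
  -- parity is chosen so that the only active extreme agent is at the assigned end `β e`.
  let active : E × Fin (2 * n + 2) → Prop := fun p => p.2.1 % 2 = if β p.1 then 1 else 0
  let x : E × Fin (2 * n + 2) → ℝ := fun p => if active p then 1 else 0
  have hend : ∀ e b, active (endAgent n e b) → b = β e := by
    intro e b h
    cases b <;> cases hb : β e <;> simp [active, endAgent, hb] at h ⊢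
  have hx : (subdivision ends n).Feasible x := by
    refine ⟨fun i => ?_, fun p => ?_⟩
    · rw [conValue_ofMaps, Finset.sum_boole]
      norm_cast
      refine Finset.card_le_one.2 fun p hp p' hp' => ?_
      simp only [Finset.mem_filter, Finset.mem_univ, true_and] at hp hp'
      obtain ⟨hp, hact⟩ := hp
      obtain ⟨hp', hact'⟩ := hp'
      rcases i with u | ⟨e, j⟩
      · obtain ⟨b, hb, hbu⟩ := subdivCon_eq_inl hp
        obtain ⟨b', hb', hbu'⟩ := subdivCon_eq_inl hp'
        rw [hb] at hact
        rw [hb'] at hact'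
        have h1 := hend _ _ hact
        have h2 := hend _ _ hact'
        have he : p.1 = p'.1 := hβ (by
          simp only
          rw [← h1, ← h2, hbu, hbu'])
        rw [hb, hb', h1, h2, he]
      · obtain ⟨h1, h2⟩ := subdivCon_eq_inr hp
        obtain ⟨h3, h4⟩ := subdivCon_eq_inr hp'
        simp only [active, h1, h3] at hact hact'
        refine Prod.ext (h1.trans h3.symm) (Fin.ext ?_)
        omega
    · simp only [x]
      split_ifs <;> simp
  refine le_trans ?_ (le_iSup₂ (f := fun x _ => (subdivision ends n).utility x) x hx)
  refine le_iInf fun k => ?_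
  obtain ⟨e, j⟩ := k
  rw [objValue_subdivision]
  have h0 : (2 * (j : ℕ)) % 2 = 0 := by omega
  have h1 : (2 * (j : ℕ) + 1) % 2 = 1 := by omega
  cases hb : β e <;> simp [x, active, hb, h0, h1]

/-- Averaging: the total is at most `|U| + n * |E| = (n + 2/3) * |E|`, spread over `(n + 1) * |E|`
objectives. -/
theorem exists_objValue_le [Nonempty E] (hcard : 3 * Fintype.card U = 2 * Fintype.card E)
    {x : E × Fin (2 * n + 2) → ℝ} (hx : (subdivision ends n).Feasible x) :
    ∃ k, (subdivision ends n).objValue x k ≤ (3 * n + 2) / (3 * n + 3) := by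
  suffices h : ∃ k ∈ (Finset.univ : Finset (E × Fin (n + 1))),
      (subdivision ends n).objValue x k ≤ (3 * n + 2) / (3 * n + 3) by
    obtain ⟨k, -, hk⟩ := h
    exact ⟨k, hk⟩
  refine Finset.exists_le_of_sum_le Finset.univ_nonempty ?_
  refine (sum_objValue_eq_sum_conValue (subdivCon ends n) (subdivObj n) x).trans_le ?_
  refine (Finset.sum_le_sum (g := fun _ => (1 : ℝ)) fun i _ => hx.1 i).trans_eq ?_
  simp only [Finset.sum_const, Finset.card_univ, Fintype.card_sum, Fintype.card_prod,
    Fintype.card_fin, nsmul_eq_mul, mul_one]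
  have : (3 * Fintype.card U : ℝ) = 2 * Fintype.card E := by exact_mod_cast hcard
  have h3 : (3 * n + 3 : ℝ) ≠ 0 := by positivity
  push_cast
  field_simp
  linear_combination this

end SubdivisionValues

/-! ### Sub-multigraphs -/

section Restriction

variable {U E : Type} (ends : E → Bool → U) (n : ℕ) (S : Set E)

theorem MaxDegreeLE.restrict [Finite E] {ends : E → Bool → U} {d : ℕ} (h : MaxDegreeLE ends d) :
    MaxDegreeLE (fun e : S => ends e) d := by
  intro u
  refine le_trans ?_ (h u)
  refine Set.ncard_le_ncard_of_injOn (fun p => (p.1.1, p.2)) (fun p hp => hp) ?_ (Set.toFinite _)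
  rintro ⟨⟨e, he⟩, b⟩ - ⟨⟨e', he'⟩, b'⟩ - heq
  simpa using heq

/-- The embedding of the subdivision of a sub-multigraph. -/
def restrictEmbedding [Fintype U] [Fintype E] [Fintype S] :
    Embedding (subdivision (fun e : S => ends e) n) (subdivision ends n) where
  onV := Prod.map Subtype.val id
  -- All branch vertices are kept, possibly as constraints without agents, so only edges need to be
  -- checked for membership in the image.
  onI := Sum.map id (Prod.map Subtype.val id)
  onK := Prod.map Subtype.val id
  onV_injective := Subtype.val_injective.prodMap Function.injective_id
  onI_injective := Function.injective_id.sumMap (Subtype.val_injective.prodMap Function.injective_id)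
  onK_injective := Subtype.val_injective.prodMap Function.injective_id
  conEdge_iff i p := by
    have : subdivCon ends n (Prod.map Subtype.val id p) =
        Sum.map id (Prod.map Subtype.val id) (subdivCon (fun e : S => ends e) n p) := by
      simp only [subdivCon, Prod.map_fst, Prod.map_snd, id]
      split_ifs <;> rfl
    change subdivCon ends n _ = _ ↔ subdivCon _ n p = i
    rw [this]
    exact (Function.injective_id.sumMap
      (Subtype.val_injective.prodMap Function.injective_id)).eq_iff
  objEdge_iff k p := by
    change Prod.map Subtype.val id (subdivObj n p) = _ ↔ subdivObj n p = k
    exact (Subtype.val_injective.prodMap Function.injective_id).eq_iff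
  a_eq _ _ := rfl
  c_eq _ _ := rfl

end Restriction

/-! ### A cubic multigraph without short cycles -/

section Cayley

/-- Words over three letters without two equal consecutive letters, of length at most `D`. -/
abbrev ReducedWord (D : ℕ) : Type :=
  {w : List (Fin 3) // w.IsChain (· ≠ ·) ∧ w.length ≤ D}

instance (D : ℕ) : Finite (ReducedWord D) :=
  ((List.finite_length_le (Fin 3) D).subset fun _ h => h.2).to_subtype

noncomputable instance (D : ℕ) : Fintype (ReducedWord D) := Fintype.ofFinite _

variable {D : ℕ}

theorem isChain_cons_of_head {c : Fin 3} {w : List (Fin 3)} (hw : w.IsChain (· ≠ ·))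
    (h : w.head? ≠ some c) : (c :: w).IsChain (· ≠ ·) := by
  cases w with
  | nil => exact List.isChain_singleton c
  | cons d w =>
    refine List.isChain_cons_cons.2 ⟨?_, hw⟩
    rintro rfl
    exact h rfl

theorem head_ne_of_isChain_cons {c : Fin 3} {w : List (Fin 3)} (h : (c :: w).IsChain (· ≠ ·)) :
    w.head? ≠ some c := by
  cases w with
  | nil => simp
  | cons d w =>
    have := (List.isChain_cons_cons.1 h).1
    simpa using this.symm

/-- Cancel the letter `c` at the front of a word, or put it there if the length permits. -/
def toggle (c : Fin 3) (w : ReducedWord D) : ReducedWord D :=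
  if h : w.1.head? = some c then
    ⟨w.1.tail, w.2.1.tail, by have := w.2.2; simp only [List.length_tail]; omega⟩
  else if hl : w.1.length < D then ⟨c :: w.1, isChain_cons_of_head w.2.1 h, hl⟩
  -- Words of maximal length that cannot be shortened are fixed, which keeps the map an involution
  -- on a finite set.
  else w

theorem toggle_cons {c : Fin 3} {w : List (Fin 3)} (h : (c :: w).IsChain (· ≠ ·))
    (hl : (c :: w).length ≤ D) :
    toggle c ⟨c :: w, h, hl⟩ = ⟨w, h.tail, (Nat.le_succ _).trans hl⟩ := by
  simp [toggle]

theorem toggle_of_cons {c : Fin 3} {w : List (Fin 3)} (h : (c :: w).IsChain (· ≠ ·))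
    (hl : (c :: w).length ≤ D) :
    toggle c ⟨w, h.tail, (Nat.le_succ _).trans hl⟩ = ⟨c :: w, h, hl⟩ := by
  have h1 := head_ne_of_isChain_cons h
  have h2 : w.length < D := hl
  simp [toggle, h1, h2]

theorem toggle_involutive (c : Fin 3) : Function.Involutive (toggle (D := D) c) := by
  rintro ⟨w, hw, hl⟩
  by_cases h : w.head? = some c
  · obtain ⟨w', rfl⟩ : ∃ w', w = c :: w' := by
      cases w with
      | nil => simp at h
      | cons d w' => exact ⟨w', by simpa using h⟩
    rw [toggle_cons hw hl, toggle_of_cons hw hl]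
  · by_cases h' : w.length < D
    · have := toggle_of_cons (isChain_cons_of_head hw h) h'
      rw [this, toggle_cons (isChain_cons_of_head hw h) h']
    · simp [toggle, h, h']

/-- The permutation of the reduced words that toggles the letter `c`. -/
def togglePerm (c : Fin 3) : Equiv.Perm (ReducedWord D) := (toggle_involutive c).toPerm

theorem togglePerm_mul_self (c : Fin 3) : togglePerm (D := D) c * togglePerm c = 1 :=
  Equiv.ext (toggle_involutive c)

/-- The bipartite double cover of the Cayley graph of the permutations of the reduced words with
respect to the three toggles. -/
def cayleyEnds (e : Equiv.Perm (ReducedWord D) × Fin 3) (b : Bool) :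
    Equiv.Perm (ReducedWord D) × Bool :=
  -- In the double cover each edge has one end on either side, so it is indexed without repetition
  -- by its `false` end and its colour.
  (if b then togglePerm e.2 * e.1 else e.1, b)

/-- The edge of colour `c` at the vertex `u`. -/
def incidentEdge (u : Equiv.Perm (ReducedWord D) × Bool) (c : Fin 3) :
    Equiv.Perm (ReducedWord D) × Fin 3 :=
  (if u.2 then togglePerm c * u.1 else u.1, c)

/-- The neighbour of `u` along the edge of colour `c`. -/
def neighbor (c : Fin 3) (u : Equiv.Perm (ReducedWord D) × Bool) :
    Equiv.Perm (ReducedWord D) × Bool :=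
  (togglePerm c * u.1, !u.2)

theorem incidentEdge_neighbor (u : Equiv.Perm (ReducedWord D) × Bool) (c : Fin 3) :
    incidentEdge (neighbor c u) c = incidentEdge u c := by
  obtain ⟨g, b⟩ := u
  cases b <;> simp [incidentEdge, neighbor, ← mul_assoc, togglePerm_mul_self]

theorem cayleyEnds_incidentEdge (u : Equiv.Perm (ReducedWord D) × Bool) (c : Fin 3) :
    cayleyEnds (incidentEdge u c) u.2 = u := by
  obtain ⟨g, b⟩ := u
  cases b <;> simp [incidentEdge, cayleyEnds, ← mul_assoc, togglePerm_mul_self]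

theorem cayleyEnds_incidentEdge_not (u : Equiv.Perm (ReducedWord D) × Bool) (c : Fin 3) :
    cayleyEnds (incidentEdge u c) (!u.2) = neighbor c u := by
  rw [← incidentEdge_neighbor]
  exact cayleyEnds_incidentEdge (neighbor c u) c

theorem incidentEdge_cayleyEnds (e : Equiv.Perm (ReducedWord D) × Fin 3) (b : Bool) :
    incidentEdge (cayleyEnds e b) e.2 = e := by
  obtain ⟨g, c⟩ := e
  cases b <;> simp [incidentEdge, cayleyEnds, ← mul_assoc, togglePerm_mul_self]

theorem maxDegreeLE_cayleyEnds : MaxDegreeLE (cayleyEnds (D := D)) 3 := by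
  intro u
  have hsub : {h : (Equiv.Perm (ReducedWord D) × Fin 3) × Bool | cayleyEnds h.1 h.2 = u} ⊆
      (fun c => (incidentEdge u c, u.2)) '' (Set.univ : Set (Fin 3)) := by
    rintro ⟨e, b⟩ rfl
    exact ⟨e.2, trivial, Prod.ext (incidentEdge_cayleyEnds e b) rfl⟩
  refine (Set.ncard_le_ncard hsub (Set.toFinite _)).trans ((Set.ncard_image_le).trans ?_)
  simp [Set.ncard_univ]

/-- The end of the walk from `(g, false)` along the colours of `w`, the last letter first. -/
def walkEnd (g : Equiv.Perm (ReducedWord D)) (w : List (Fin 3)) :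
    Equiv.Perm (ReducedWord D) × Bool :=
  w.foldr neighbor (g, false)

theorem walkEnd_cons (g : Equiv.Perm (ReducedWord D)) (c : Fin 3) (w : List (Fin 3)) :
    walkEnd g (c :: w) = neighbor c (walkEnd g w) := rfl

/-- Applied to the preimage of the empty word, the permutation at the end of the walk spells out the
walk. Thus reduced walks of length at most `D` from one vertex have different ends. -/
theorem walkEnd_apply (g : Equiv.Perm (ReducedWord D)) {w : List (Fin 3)}
    (hw : w.IsChain (· ≠ ·)) (hl : w.length ≤ D) :
    (walkEnd g w).1 (g⁻¹ ⟨[], List.isChain_nil, Nat.zero_le D⟩) = ⟨w, hw, hl⟩ := by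
  induction w with
  | nil => simp [walkEnd]
  | cons c w ih =>
    rw [walkEnd_cons, neighbor, Equiv.Perm.mul_apply, ih hw.tail ((Nat.le_succ _).trans hl)]
    exact toggle_of_cons hw hl

theorem walkEnd_injOn (g : Equiv.Perm (ReducedWord D)) {w w' : List (Fin 3)}
    (hw : w.IsChain (· ≠ ·)) (hl : w.length ≤ D) (hw' : w'.IsChain (· ≠ ·)) (hl' : w'.length ≤ D)
    (h : walkEnd g w = walkEnd g w') : w = w' := by
  have h1 := walkEnd_apply g hw hl
  rw [h, walkEnd_apply g hw' hl'] at h1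
  exact (congrArg Subtype.val h1).symm

/-- The edges on non-backtracking walks of length at most `t` from `(g, false)`. -/
def nearEdges (g : Equiv.Perm (ReducedWord D)) (t : ℕ) : Set (Equiv.Perm (ReducedWord D) × Fin 3) :=
  {e | ∃ c w, (c :: w).IsChain (· ≠ ·) ∧ (c :: w).length ≤ t ∧ e = incidentEdge (walkEnd g w) c}

theorem nearEdges_mono (g : Equiv.Perm (ReducedWord D)) {s t : ℕ} (h : s ≤ t) :
    nearEdges g s ⊆ nearEdges g t :=
  fun _ ⟨c, w, hw, hl, he⟩ => ⟨c, w, hw, hl.trans h, he⟩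

theorem mem_nearEdges_one (g : Equiv.Perm (ReducedWord D)) (c : Fin 3) :
    (g, c) ∈ nearEdges g 1 :=
  ⟨c, [], List.isChain_singleton c, le_rfl, rfl⟩

/-- The near edges form a forest: each of them can be assigned to its far end. -/
theorem exists_orientation_nearEdges (g : Equiv.Perm (ReducedWord D)) :
    ∃ β : nearEdges g D → Bool, Function.Injective fun e => cayleyEnds e.1 (β e) := by
  choose c w hw hl he using fun e : nearEdges g D => e.2
  -- The far end of an edge is the end of the walk that finishes with this edge; it determines the
  -- word, hence the edge.
  refine ⟨fun e => !(walkEnd g (w e)).2, fun e e' h => ?_⟩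
  have hfar : ∀ e, cayleyEnds e.1 (!(walkEnd g (w e)).2) = walkEnd g (c e :: w e) := by
    intro e
    rw [he e]
    exact cayleyEnds_incidentEdge_not _ _
  simp only [hfar] at h
  have hcw := walkEnd_injOn g (hw e) (hl e) (hw e') (hl e') h
  simp only [List.cons.injEq] at hcw
  apply Subtype.ext
  rw [he e, he e', hcw.1, hcw.2]

theorem exists_walkEnd_of_mem_nearEdges {g : Equiv.Perm (ReducedWord D)} {t : ℕ}
    {e : Equiv.Perm (ReducedWord D) × Fin 3} (he : e ∈ nearEdges g t) (b : Bool) :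
    ∃ w : List (Fin 3), w.IsChain (· ≠ ·) ∧ w.length ≤ t ∧ cayleyEnds e b = walkEnd g w := by
  obtain ⟨c, w, hw, hl, rfl⟩ := he
  by_cases hb : b = (walkEnd g w).2
  · exact ⟨w, hw.tail, (Nat.le_succ _).trans hl, by rw [hb, cayleyEnds_incidentEdge]⟩
  · have hb' : b = !(walkEnd g w).2 := by
      cases b <;> cases h : (walkEnd g w).2 <;> simp_all
    exact ⟨c :: w, hw, hl, by rw [hb', cayleyEnds_incidentEdge_not, walkEnd_cons]⟩

/-- An edge at the end of a reduced walk either is the last edge of that walk or prolongs it to a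
longer reduced walk. -/
theorem mem_nearEdges_succ {g : Equiv.Perm (ReducedWord D)} {t : ℕ} {w : List (Fin 3)}
    (hw : w.IsChain (· ≠ ·)) (hl : w.length ≤ t) {e : Equiv.Perm (ReducedWord D) × Fin 3} {b : Bool}
    (he : cayleyEnds e b = walkEnd g w) : e ∈ nearEdges g (t + 1) := by
  have he' : e = incidentEdge (walkEnd g w) e.2 := by
    rw [← he, incidentEdge_cayleyEnds]
  by_cases h : w.head? = some e.2
  · obtain ⟨w', rfl⟩ : ∃ w', w = e.2 :: w' := by
      cases w with
      | nil => simp at h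
      | cons d w' => exact ⟨w', by simpa using h⟩
    refine ⟨e.2, w', hw, hl.trans (Nat.le_succ t), ?_⟩
    rw [walkEnd_cons, incidentEdge_neighbor] at he'
    exact he'
  · exact ⟨e.2, w, isChain_cons_of_head hw h, Nat.succ_le_succ hl, he'⟩

/-- The nodes of the subdivided Cayley graph that lie on near edges. -/
def NearNode {n : ℕ} (g : Equiv.Perm (ReducedWord D)) (t : ℕ) :
    (subdivision (cayleyEnds (D := D)) n).Node → Prop
  | .agent p => p.1 ∈ nearEdges g t
  | .obj k => k.1 ∈ nearEdges g t
  | .con (.inr i) => i.1 ∈ nearEdges g t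
  | .con (.inl u) => ∃ w : List (Fin 3), w.IsChain (· ≠ ·) ∧ w.length ≤ t ∧ u = walkEnd g w

theorem NearNode.mono {n : ℕ} {g : Equiv.Perm (ReducedWord D)} {s t : ℕ} (hst : s ≤ t)
    {x : (subdivision (cayleyEnds (D := D)) n).Node} (h : NearNode g s x) : NearNode g t x := by
  rcases x with p | (u | i) | k
  · exact nearEdges_mono g hst h
  · obtain ⟨w, hw, hl, hu⟩ := h
    exact ⟨w, hw, hl.trans hst, hu⟩
  · exact nearEdges_mono g hst h
  · exact nearEdges_mono g hst h

theorem NearNode.of_adj {n : ℕ} {g : Equiv.Perm (ReducedWord D)} {t : ℕ}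
    {x y : (subdivision (cayleyEnds (D := D)) n).Node} (h : NearNode g t x)
    (hadj : (subdivision (cayleyEnds (D := D)) n).graph.Adj x y) : NearNode g (t + 1) y := by
  rcases x with p | (u | i) | k <;> rcases y with p' | (u' | i') | k' <;>
    first | exact hadj.elim | skip
  · have hc : subdivCon cayleyEnds n p = .inl u' := hadj
    obtain ⟨b, -, rfl⟩ := subdivCon_eq_inl hc
    obtain ⟨w, hw, hl, hu⟩ := exists_walkEnd_of_mem_nearEdges h b
    exact ⟨w, hw, hl.trans (Nat.le_succ t), hu⟩
  · have hc : subdivCon cayleyEnds n p = .inr (i'.1, i'.2) := hadj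
    have h1 := (subdivCon_eq_inr hc).1
    exact nearEdges_mono g (Nat.le_succ t) (h1 ▸ h : i'.1 ∈ nearEdges g t)
  · have hc : subdivObj n p = (k'.1, k'.2) := hadj
    have h1 := (subdivObj_eq hc).1
    exact nearEdges_mono g (Nat.le_succ t) (h1 ▸ h : k'.1 ∈ nearEdges g t)
  · have hc : subdivCon cayleyEnds n p' = .inl u := hadj
    obtain ⟨b, -, hb⟩ := subdivCon_eq_inl hc
    obtain ⟨w, hw, hl, hu⟩ := h
    exact mem_nearEdges_succ hw hl (hb.trans hu)
  · have hc : subdivCon cayleyEnds n p' = .inr (i.1, i.2) := hadj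
    have h1 := (subdivCon_eq_inr hc).1
    exact nearEdges_mono g (Nat.le_succ t) (h1.symm ▸ h : p'.1 ∈ nearEdges g t)
  · have hc : subdivObj n p' = (k.1, k.2) := hadj
    have h1 := (subdivObj_eq hc).1
    exact nearEdges_mono g (Nat.le_succ t) (h1.symm ▸ h : p'.1 ∈ nearEdges g t)

theorem nearNode_of_mem_ball {n : ℕ} {g : Equiv.Perm (ReducedWord D)}
    {p : (Equiv.Perm (ReducedWord D) × Fin 3) × Fin (2 * n + 2)} (hp : p.1 ∈ nearEdges g 1)
    {t : ℕ} {x : (subdivision (cayleyEnds (D := D)) n).Node}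
    (hx : x ∈ (subdivision (cayleyEnds (D := D)) n).ball (.agent p) t) :
    NearNode g (t + 1) x := by
  induction t generalizing x with
  | zero =>
    obtain rfl := mem_ball_zero.1 hx
    exact hp
  | succ t ih =>
    obtain ⟨y, hy, rfl | hadj⟩ := mem_ball_succ.1 hx
    · exact (ih hy).mono (Nat.le_succ _)
    · exact (ih hy).of_adj hadj

theorem nearNode_mem_range {n : ℕ} {g : Equiv.Perm (ReducedWord D)} {t : ℕ}
    [Fintype (nearEdges g t)] {x : (subdivision (cayleyEnds (D := D)) n).Node}
    (hx : NearNode g t x) :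
    x ∈ Set.range (restrictEmbedding cayleyEnds n (nearEdges g t)).onNode := by
  rcases x with p | (u | i) | k
  · exact ⟨.agent (⟨p.1, hx⟩, p.2), rfl⟩
  · exact ⟨.con (.inl u), rfl⟩
  · exact ⟨.con (.inr (⟨i.1, hx⟩, i.2)), rfl⟩
  · exact ⟨.obj (⟨k.1, hx⟩, k.2), rfl⟩

end Cayley

/-! ### Lower bound on the approximation ratio -/

/-- For every local horizon, the approximation ratio on a family that contains the subdivisions of
all multigraphs of maximum degree three is bounded from below. -/
theorem le_ratio_of_isLocalApproximation {n : ℕ} {F : Set MaxMinLP}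
    (hF : ∀ (U E : Type) [Fintype U] [Fintype E] (ends : E → Bool → U), MaxDegreeLE ends 3 →
      subdivision ends n ∈ F)
    {A : LocalRule} {r : ℕ} {α : ℝ} (hA : IsLocalApproximation A r α F) :
    (3 * n + 3 : ℝ) ≤ α * (3 * n + 2) := by
  classical
  obtain ⟨hα, hA⟩ := hA
  have hα0 : 0 < α := by linarith
  -- The views concern balls of radius `r + 1` around an agent on a near edge of depth 1, so words
  -- of length `r + 2` suffice.
  let ends := cayleyEnds (D := r + 2)
  have hdeg : MaxDegreeLE ends 3 := maxDegreeLE_cayleyEnds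
  obtain ⟨ident, hident⟩ := Countable.exists_injective_nat (subdivision ends n).Node
  obtain ⟨hfeas, -⟩ := hA _ (hF _ _ ends hdeg) (rankLabelling _ ident hident)
  have hcard : 3 * Fintype.card (Equiv.Perm (ReducedWord (r + 2)) × Bool) =
      2 * Fintype.card (Equiv.Perm (ReducedWord (r + 2)) × Fin 3) := by
    simp only [Fintype.card_prod, Fintype.card_bool, Fintype.card_fin]
    ring
  -- The bad objective may be anywhere; the forest is based at the `false` end `g` of its own edge.
  obtain ⟨⟨⟨g, c⟩, j⟩, hk⟩ := exists_objValue_le (ends := ends) hcard hfeas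
  have hgc : (g, c) ∈ nearEdges g (r + 2) := nearEdges_mono g (by omega) (mem_nearEdges_one g c)
  let φ := restrictEmbedding ends n (nearEdges g (r + 2))
  have hout : ∀ q, (φ.pullback ident hident).output A r (⟨(g, c), hgc⟩, q) =
      (rankLabelling _ ident hident).output A r ((g, c), q) := fun q =>
    φ.output_pullback ident hident (v := (⟨(g, c), hgc⟩, q))
      (fun x hx => nearNode_mem_range (nearNode_of_mem_ball (mem_nearEdges_one g c) hx)) A
  obtain ⟨-, happrox⟩ := hA (subdivision (fun e : nearEdges g (r + 2) => ends e) n)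
    (hF _ _ _ (hdeg.restrict (nearEdges g (r + 2)))) (φ.pullback ident hident)
  have hval := happrox (⟨(g, c), hgc⟩, j)
  rw [objValue_subdivision, hout, hout, ← objValue_subdivision (ends := ends)] at hval
  obtain ⟨β, hβ⟩ := exists_orientation_nearEdges g
  have hopt : (1 : EReal) / α ≤ (subdivision (fun e : nearEdges g (r + 2) => ends e) n).opt / α :=
    EReal.div_le_div_right_of_nonneg (by exact_mod_cast hα0.le) (one_le_opt_subdivision β hβ)
  have hreal : ((1 / α : ℝ) : EReal) ≤ ((3 * n + 2) / (3 * n + 3) : ℝ) := by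
    refine le_trans ?_ (hopt.trans (hval.trans (EReal.coe_le_coe_iff.2 hk)))
    rw [EReal.coe_div, EReal.coe_one]
  rw [EReal.coe_le_coe_iff, div_le_div_iff₀ hα0 (by positivity)] at hreal
  linarith

end MaxMinLP

theorem theorem3 (ΔI ΔK : ℕ) (hI : 3 ≤ ΔI) (hK : 3 ≤ ΔK)
    (δ : ℝ) (hδ : 0 < δ) (hδ' : δ < 1 / 10) :
    (¬ ∃ (A : MaxMinLP.LocalRule) (r : ℕ) (α : ℝ), α < 1 + δ / 2 ∧
      MaxMinLP.IsLocalApproximation A r α {L | L.DegreeBounded ΔI ΔK}) ∧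
    ∃ R : ℕ, ¬ ∃ (A : MaxMinLP.LocalRule) (r : ℕ) (α : ℝ), α < 1 + δ / 2 ∧
      MaxMinLP.IsLocalApproximation A r α
        {L | L.DegreeBounded ΔI ΔK ∧ L.IsBipartite ∧ L.PositiveCoefficients ∧
          L.BoundedRelativeGrowth δ R} := by
  -- The upper bound `2nδ ≤ 1` serves the ratio, and `1 < 2(n+1)δ` leaves room for the growth.
  set n := ⌊1 / (2 * δ)⌋₊
  have hnle : (n : ℝ) * (2 * δ) ≤ 1 := by
    rw [← le_div_iff₀ (by positivity)]
    exact Nat.floor_le (by positivity)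
  have hnlt : 1 < ((n : ℝ) + 1) * (2 * δ) := by
    rw [← div_lt_iff₀ (by positivity)]
    exact Nat.lt_floor_add_one _
  have hgap : 0 < δ - 1 / (2 * n + 2) := by
    rw [sub_pos, div_lt_iff₀ (by positivity)]
    linarith
  have hratio : ∀ α : ℝ, α < 1 + δ / 2 → ¬ (3 * n + 3 : ℝ) ≤ α * (3 * n + 2) := by
    intro α hα h
    have h1 : α * (3 * n + 2) < (1 + δ / 2) * (3 * n + 2) :=
      mul_lt_mul_of_pos_right hα (by positivity)
    -- `(δ/2)(3n+2) = 3nδ/2 + δ ≤ 3/4 + δ < 1`.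
    nlinarith
  set R := ⌈16 / (δ - 1 / (2 * n + 2))⌉₊
  have hRle : 16 ≤ (δ - 1 / (2 * n + 2)) * R := by
    rw [mul_comm, ← div_le_iff₀ hgap]
    exact Nat.le_ceil _
  refine ⟨?_, R, ?_⟩
  · rintro ⟨A, r, α, hα, hA⟩
    refine hratio α hα (MaxMinLP.le_ratio_of_isLocalApproximation ?_ hA)
    intro U E _ _ ends hdeg
    exact MaxMinLP.degreeBounded_subdivision hdeg hI (by omega)
  · rintro ⟨A, r, α, hα, hA⟩
    refine hratio α hα (MaxMinLP.le_ratio_of_isLocalApproximation ?_ hA)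
    intro U E _ _ ends hdeg
    exact ⟨MaxMinLP.degreeBounded_subdivision hdeg hI (by omega),
      MaxMinLP.isBipartite_ofMaps _ _, MaxMinLP.positiveCoefficients_ofMaps _ _,
      MaxMinLP.boundedRelativeGrowth_subdivision hdeg hδ.le hRle⟩
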